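/- Let $\mathbb W=(W_0,W_1)$ be a bi-isometry on a complex Hilbert space $\mathfrak K$, that is, a pair of commuting isometric operators on $\mathfrak K$. For $j\in\{0,1\}$, $\mathbb W$ is called $\{j\}$-pure if the only closed subspace $\mathfrak M$ of $\mathfrak K$ that reduces both $W_0$ and $W_1$ and for which $W_j|\mathfrak M$ is unitary on $\mathfrak M$ is $\mathfrak M=\{0\}$. Further notions: - Let $\mathfrak H=\bigoplus_{k\ge0}W_0^k(\mathfrak K\ominus W_0\mathfrak K)$ be the space of the shift part in the von Neumann-Wold decomposition of $W_0$, let $V_0=W_0|\mathfrak H$, $A=P_{\mathfrak H}W_1|\mathfrak H$ and $\mathfrak E=\mathfrak H\ominus V_0\mathfrak H$. The characteristic function of $\mathbb W$ is $\Theta_{\mathbb W}(z)=\sum_{k\ge0}z^kP_{\mathfrak E}V_0^{*k}A|\mathfrak E\in\mathcal L(\mathfrak E)$, $|z|<1$. - The pivotal operator of a bi-isometry $(W_0,W_1)$ is the operator on $\ker W_1^*$ whose adjoint is $W_0^*|\ker W_1^*$. The pivotal operator of $(W_1,W_0)$ is thus the operator on $\ker W_0^*$ whose adjoint is $W_1^*|\ker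 W_0^*$. - For a complex Hilbert space $\mathfrak F$, $H^2(\mathbb D^2)\otimes\mathfrak F$ is the Hilbert space of square summable power series $f(z_0,z_1)=\sum_{m,n\ge0}z_0^mz_1^nf_{m,n}$ with coefficients $f_{m,n}\in\mathfrak F$, and $\mathbb W_{\mathfrak F}$ is the bi-isometry on it that consists of the multiplications by $z_0$ and by $z_1$. Assume that $\mathbb W$ is both $\{0\}$-pure and $\{1\}$-pure. Then the following conditions are equivalent. 1. $\mathbb W$ is unitarily equivalent to $\mathbb W_{\mathfrak F}$ for some Hilbert space $\mathfrak F$ (that is, there is one unitary operator $U$ from $\mathfrak K$ onto $H^2(\mathbb D^2)\otimes\mathfrak F$ such that $UW_j$ equals multiplication by $z_j$ composed with $U$, for $j=0,1$). 2. $\mathbb W$ is doubly commuting, that is, $W_0W_1^*=W_1^*W_0$. 3. $\Theta_{\mathbb W}$ is a constant isometry, that is, there is an isometry $S\in\mathcal L(\mathfrak E)$ with $\Theta_{\mathbb W}(z)=S$ for all $|z|<1$. 4. The pivotal operator of $(W_1,W_0)$ is an isometry. 5. The pivotal operator of $\mathbb W=(W_0,W_1)$ is an isometry. -/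

import Mathlib

universe u

open scoped ENNReal

noncomputable section

/-! ### Families of operators, reducing subspaces, purity -/

/-- A linear subspace `M` reduces the family `V` if both `M` and its orthogonal complement are
invariant under every member of the family. -/
def IsReducing {ι K : Type*} [NormedAddCommGroup K] [InnerProductSpace ℂ K]
    (V : ι → K →L[ℂ] K) (M : Submodule ℂ K) : Prop :=
  ∀ i, (∀ x ∈ M, V i x ∈ M) ∧ (∀ x ∈ Mᗮ, V i x ∈ Mᗮ)

/-- The restriction of `T` to `M` is a unitary operator on `M`, that is, an isometry of `M`
onto `M`. -/
def IsUnitaryOn {K : Type*} [NormedAddCommGroup K] [InnerProductSpace ℂ K]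
    (T : K →L[ℂ] K) (M : Submodule ℂ K) : Prop :=
  (∀ x ∈ M, T x ∈ M) ∧ (∀ x ∈ M, ‖T x‖ = ‖x‖) ∧ (∀ y ∈ M, ∃ x ∈ M, T x = y)

/-- The family `V` is `J`-pure: it has no direct summand, acting on a nonzero space, on which all
`V j` with `j ∈ J` are unitary. -/
def IsPureFamily {ι K : Type*} [NormedAddCommGroup K] [InnerProductSpace ℂ K]
    (V : ι → K →L[ℂ] K) (J : Set ι) : Prop :=
  ∀ M : Submodule ℂ K, IsClosed (M : Set K) → IsReducing V M →
    (∀ j ∈ J, IsUnitaryOn (V j) M) → M = ⊥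

/-! ### Analytic function associated with a pair of operators -/

/-- The operator-valued power series `∑ z^k T_k`. -/
def operatorSeries {E : Type*} [NormedAddCommGroup E] [InnerProductSpace ℂ E]
    (T : ℕ → E →L[ℂ] E) (z : ℂ) : E →L[ℂ] E :=
  ∑' k : ℕ, z ^ k • T k

/-- If the coefficients are bounded, the series converges in operator norm on the unit disk. -/
theorem hasSum_operatorSeries {E : Type*} [NormedAddCommGroup E] [InnerProductSpace ℂ E]
    [CompleteSpace E] (T : ℕ → E →L[ℂ] E) {C : ℝ} (hT : ∀ k, ‖T k‖ ≤ C) {z : ℂ}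
    (hz : ‖z‖ < 1) : HasSum (fun k : ℕ => z ^ k • T k) (operatorSeries T z) := by
  have hg : Summable fun k : ℕ => ‖z‖ ^ k * C :=
    (summable_geometric_of_lt_one (norm_nonneg z) hz).mul_right _
  have hb : ∀ k : ℕ, ‖z ^ k • T k‖ ≤ ‖z‖ ^ k * C := by
    intro k
    rw [norm_smul, norm_pow]
    exact mul_le_mul_of_nonneg_left (hT k) (by positivity)
  exact (Summable.of_norm_bounded hg hb).hasSum

/-- The wandering subspace `H ⊖ V H` of an operator `V` on `H`. -/
def wanderingSpace {H : Type*} [NormedAddCommGroup H] [InnerProductSpace ℂ H]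
    (V : H →L[ℂ] H) : Submodule ℂ H :=
  V.rangeᗮ

instance wanderingSpace.completeSpace {H : Type*} [NormedAddCommGroup H] [InnerProductSpace ℂ H]
    [CompleteSpace H] (V : H →L[ℂ] H) : CompleteSpace (wanderingSpace V) := by
  unfold wanderingSpace
  infer_instance

/-- The coefficients `Θ_k = P_E V*^k A | E` of a pair `(V, A)`, where `E = H ⊖ V H`. -/
def pairCoeff {H : Type*} [NormedAddCommGroup H] [InnerProductSpace ℂ H] [CompleteSpace H]
    (V A : H →L[ℂ] H) (k : ℕ) : wanderingSpace V →L[ℂ] wanderingSpace V :=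
  (wanderingSpace V).orthogonalProjectionOnto ∘L
    (((ContinuousLinearMap.adjoint V) ^ k) ∘L A) ∘L (wanderingSpace V).subtypeL

/-- The operator-valued function `Θ(z) = ∑ z^k Θ_k` of a pair `(V, A)`, used for `|z| < 1`. -/
def pairFunction {H : Type*} [NormedAddCommGroup H] [InnerProductSpace ℂ H] [CompleteSpace H]
    (V A : H →L[ℂ] H) (z : ℂ) : wanderingSpace V →L[ℂ] wanderingSpace V :=
  operatorSeries (pairCoeff V A) z

theorem norm_pairCoeff_le {H : Type*} [NormedAddCommGroup H] [InnerProductSpace ℂ H]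
    [CompleteSpace H] (V A : H →L[ℂ] H) (hV : ‖V‖ ≤ 1) (k : ℕ) :
    ‖pairCoeff V A k‖ ≤ ‖A‖ := by
  have h1 : ∀ (n : ℕ) (y : H), ‖((ContinuousLinearMap.adjoint V) ^ n) y‖ ≤ ‖y‖ := by
    intro n
    induction n with
    | zero => intro y; simp
    | succ n ih =>
      intro y
      rw [pow_succ]
      change ‖((ContinuousLinearMap.adjoint V) ^ n) (ContinuousLinearMap.adjoint V y)‖ ≤ ‖y‖
      refine (ih _).trans ?_
      refine (ContinuousLinearMap.le_opNorm _ y).trans ?_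
      rw [LinearIsometryEquiv.norm_map]
      exact mul_le_of_le_one_left (norm_nonneg _) hV
  refine ContinuousLinearMap.opNorm_le_bound _ (norm_nonneg _) fun x => ?_
  refine ((wanderingSpace V).norm_orthogonalProjectionOnto_apply_le _).trans ?_
  refine (h1 k _).trans ?_
  exact A.le_opNorm (x : H)

/-! ### Bi-isometries -/

/-- A bi-isometry on `K`: a pair `(W_0, W_1)` of commuting isometric operators on `K`. -/
structure BiIsometry (K : Type*) [NormedAddCommGroup K] [InnerProductSpace ℂ K] where
  op : Fin 2 → K →L[ℂ] K
  norm_map : ∀ i x, ‖op i x‖ = ‖x‖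
  comm : ∀ i j x, op i (op j x) = op j (op i x)

namespace BiIsometry

/-- The bi-isometry `(W_1, W_0)`. -/
def swap {K : Type*} [NormedAddCommGroup K] [InnerProductSpace ℂ K] (W : BiIsometry K) :
    BiIsometry K where
  op := ![W.op 1, W.op 0]
  norm_map := by
    intro i x
    fin_cases i
    · exact W.norm_map 1 x
    · exact W.norm_map 0 x
  comm := by
    intro i j x
    fin_cases i <;> fin_cases j
    · rfl
    · exact W.comm 1 0 x
    · exact W.comm 0 1 x
    · rfl

/-- `J`-purity of a bi-isometry, for `J ⊆ {0, 1}`. -/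
def IsPure {K : Type*} [NormedAddCommGroup K] [InnerProductSpace ℂ K] (W : BiIsometry K)
    (J : Set (Fin 2)) : Prop :=
  IsPureFamily W.op J

/-- Unitary equivalence: one unitary operator intertwines both members of the pairs. -/
def UnitarilyEquivalent {K K' : Type*} [NormedAddCommGroup K] [InnerProductSpace ℂ K]
    [NormedAddCommGroup K'] [InnerProductSpace ℂ K'] (W : BiIsometry K) (W' : BiIsometry K') :
    Prop :=
  ∃ U : K ≃ₗᵢ[ℂ] K', ∀ i x, U (W.op i x) = W'.op i (U x)

/-- `W` is doubly commuting: `W_0 W_1* = W_1* W_0`. -/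
def DoublyCommuting {K : Type*} [NormedAddCommGroup K] [InnerProductSpace ℂ K] [CompleteSpace K]
    (W : BiIsometry K) : Prop :=
  W.op 0 ∘L ContinuousLinearMap.adjoint (W.op 1) =
    ContinuousLinearMap.adjoint (W.op 1) ∘L W.op 0

/-- The space `H` of the shift part in the von Neumann-Wold decomposition of `W_0`: the closed
linear span of the (mutually orthogonal) spaces `W_0^k (K ⊖ W_0 K)`. -/
def shiftSpace {K : Type*} [NormedAddCommGroup K] [InnerProductSpace ℂ K] (W : BiIsometry K) :
    Submodule ℂ K :=
  (⨆ k : ℕ, (wanderingSpace (W.op 0)).map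
    (((W.op 0) ^ k : K →L[ℂ] K) : K →ₗ[ℂ] K)).topologicalClosure

instance shiftSpace.completeSpace {K : Type*} [NormedAddCommGroup K] [InnerProductSpace ℂ K]
    [CompleteSpace K] (W : BiIsometry K) : CompleteSpace W.shiftSpace := by
  unfold shiftSpace
  infer_instance

theorem op_zero_mem_shiftSpace {K : Type*} [NormedAddCommGroup K] [InnerProductSpace ℂ K]
    (W : BiIsometry K) {x : K} (hx : x ∈ W.shiftSpace) : W.op 0 x ∈ W.shiftSpace := by
  have hle : (⨆ k : ℕ, (wanderingSpace (W.op 0)).map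
      (((W.op 0) ^ k : K →L[ℂ] K) : K →ₗ[ℂ] K)) ≤
      (⨆ k : ℕ, (wanderingSpace (W.op 0)).map
        (((W.op 0) ^ k : K →L[ℂ] K) : K →ₗ[ℂ] K)).comap (W.op 0 : K →ₗ[ℂ] K) := by
    refine iSup_le fun k => ?_
    rintro _ ⟨e, he, rfl⟩
    refine Submodule.mem_iSup_of_mem (k + 1) ⟨e, he, ?_⟩
    rw [pow_succ']
    rfl
  exact map_mem_closure (W.op 0).continuous hx fun y hy => hle hy

/-- First member of the characteristic pair: the unilateral shift `V_0 = W_0 | H`. -/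
def charShift {K : Type*} [NormedAddCommGroup K] [InnerProductSpace ℂ K]
    (W : BiIsometry K) : W.shiftSpace →L[ℂ] W.shiftSpace :=
  (W.op 0).restrict fun _ hx => W.op_zero_mem_shiftSpace hx

/-- Second member of the characteristic pair: the compression `A = P_H W_1 | H`. -/
def charContraction {K : Type*} [NormedAddCommGroup K] [InnerProductSpace ℂ K] [CompleteSpace K]
    (W : BiIsometry K) : W.shiftSpace →L[ℂ] W.shiftSpace :=
  W.shiftSpace.orthogonalProjectionOnto ∘L W.op 1 ∘L W.shiftSpace.subtypeL

/-- The characteristic function `Θ_W` of `W`, with values operators on `E = H ⊖ V_0 H`. -/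
def charFunction {K : Type*} [NormedAddCommGroup K] [InnerProductSpace ℂ K] [CompleteSpace K]
    (W : BiIsometry K) (z : ℂ) :
    wanderingSpace W.charShift →L[ℂ] wanderingSpace W.charShift :=
  pairFunction W.charShift W.charContraction z

theorem norm_charShift_le {K : Type*} [NormedAddCommGroup K] [InnerProductSpace ℂ K]
    (W : BiIsometry K) : ‖W.charShift‖ ≤ 1 := by
  refine ContinuousLinearMap.opNorm_le_bound _ zero_le_one fun x => ?_
  rw [one_mul]
  exact (W.norm_map 0 (x : K)).le

/-- The coefficients of the characteristic function are bounded, so that its power series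
converges on the unit disk. -/
theorem norm_charCoeff_le {K : Type*} [NormedAddCommGroup K] [InnerProductSpace ℂ K]
    [CompleteSpace K] (W : BiIsometry K) (k : ℕ) :
    ‖pairCoeff W.charShift W.charContraction k‖ ≤ ‖W.charContraction‖ :=
  norm_pairCoeff_le _ _ W.norm_charShift_le k

/-- `Θ_W` is a constant isometry on the unit disk. -/
def CharFunctionIsConstantIsometry {K : Type*} [NormedAddCommGroup K] [InnerProductSpace ℂ K]
    [CompleteSpace K] (W : BiIsometry K) : Prop :=
  ∃ S : wanderingSpace W.charShift →L[ℂ] wanderingSpace W.charShift,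
    Isometry S ∧ ∀ z : ℂ, ‖z‖ < 1 → W.charFunction z = S

theorem adjoint_mem_ker {K : Type*} [NormedAddCommGroup K] [InnerProductSpace ℂ K]
    [CompleteSpace K] (W : BiIsometry K) {x : K}
    (hx : x ∈ (ContinuousLinearMap.adjoint (W.op 1)).ker) :
    ContinuousLinearMap.adjoint (W.op 0) x ∈ (ContinuousLinearMap.adjoint (W.op 1)).ker := by
  have hx' : ContinuousLinearMap.adjoint (W.op 1) x = 0 := hx
  change ContinuousLinearMap.adjoint (W.op 1) (ContinuousLinearMap.adjoint (W.op 0) x) = 0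
  refine ext_inner_right ℂ fun y => ?_
  rw [ContinuousLinearMap.adjoint_inner_left, ContinuousLinearMap.adjoint_inner_left,
    W.comm 0 1 y, ← ContinuousLinearMap.adjoint_inner_left, hx', inner_zero_left,
    inner_zero_left]

/-- The pivotal operator of `(W_0, W_1)`: the operator on `ker W_1*` whose adjoint is
`W_0* | ker W_1*`. -/
def pivotalOperator {K : Type*} [NormedAddCommGroup K] [InnerProductSpace ℂ K] [CompleteSpace K]
    (W : BiIsometry K) :
    (ContinuousLinearMap.adjoint (W.op 1)).ker →L[ℂ] (ContinuousLinearMap.adjoint (W.op 1)).ker :=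
  ContinuousLinearMap.adjoint
    ((ContinuousLinearMap.adjoint (W.op 0)).restrict fun _ hx => W.adjoint_mem_ker hx)

end BiIsometry

/-! ### The Hardy space of the bidisk with coefficients in `F` -/

/-- The Hilbert space `H²(𝔻²) ⊗ F` of square summable power series
`f(z_0, z_1) = ∑ z_0^m z_1^n f_{m,n}` with coefficients `f_{m,n}` in `F`. -/
abbrev HardyBidisk (F : Type*) [NormedAddCommGroup F] : Type _ :=
  lp (fun _ : ℕ × ℕ => F) 2

namespace HardyBidisk

/-- The value at a point `z` of the bidisk of the function represented by `f`. -/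
def eval {F : Type*} [NormedAddCommGroup F] [InnerProductSpace ℂ F]
    (f : HardyBidisk F) (z : Fin 2 → ℂ) : F :=
  ∑' p : ℕ × ℕ, (z 0 ^ p.1 * z 1 ^ p.2) • f p

/-- The power series converges (absolutely) at every point of the bidisk. -/
theorem hasSum_eval {F : Type*} [NormedAddCommGroup F] [InnerProductSpace ℂ F] [CompleteSpace F]
    (f : HardyBidisk F) {z : Fin 2 → ℂ} (hz : ∀ i, ‖z i‖ < 1) :
    HasSum (fun p : ℕ × ℕ => (z 0 ^ p.1 * z 1 ^ p.2) • f p) (eval f z) := by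
  refine Summable.hasSum ?_
  have hg : Summable fun p : ℕ × ℕ => ‖z 0‖ ^ p.1 * ‖z 1‖ ^ p.2 :=
    (summable_geometric_of_lt_one (norm_nonneg _) (hz 0)).mul_of_nonneg
      (summable_geometric_of_lt_one (norm_nonneg _) (hz 1))
      (fun _ => by positivity) (fun _ => by positivity)
  refine Summable.of_norm_bounded (hg.mul_right ‖f‖) fun p => ?_
  rw [norm_smul, norm_mul, norm_pow, norm_pow]
  exact mul_le_mul_of_nonneg_left (lp.norm_apply_le_norm two_ne_zero f p) (by positivity)

/-- Raising the exponent of `z_i` by one. -/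
def raise (i : Fin 2) (p : ℕ × ℕ) : ℕ × ℕ :=
  if i = 0 then (p.1 + 1, p.2) else (p.1, p.2 + 1)

theorem raise_injective (i : Fin 2) : Function.Injective (raise i) := by
  rintro ⟨a, b⟩ ⟨c, d⟩ h
  unfold raise at h
  split_ifs at h <;> simp_all

theorem hasSum_extend_raise {F : Type*} [NormedAddCommGroup F] (i : Fin 2) (f : HardyBidisk F) :
    HasSum (fun p => ‖Function.extend (raise i) f 0 p‖ ^ (2 : ℝ≥0∞).toReal)
      (‖f‖ ^ (2 : ℝ≥0∞).toReal) := by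
  have h2 : 0 < (2 : ℝ≥0∞).toReal := by simp
  rw [← (raise_injective i).hasSum_iff]
  · have := lp.hasSum_norm h2 f
    refine this.congr_fun ?_
    intro p
    simp [(raise_injective i).extend_apply]
  · intro p hp
    rw [Function.extend_apply' _ _ _ (fun ⟨q, hq⟩ => hp ⟨q, hq⟩)]
    simp

/-- Multiplication by the coordinate `z_i`: the coefficients are moved along `raise i`, and the
coefficients of monomials not divisible by `z_i` vanish. -/
def mulCoord {F : Type*} [NormedAddCommGroup F] [InnerProductSpace ℂ F] (i : Fin 2) :
    HardyBidisk F →ₗᵢ[ℂ] HardyBidisk F where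
  toFun f := ⟨Function.extend (raise i) f 0, memℓp_gen (hasSum_extend_raise i f).summable⟩
  map_add' f g := by
    ext p
    change Function.extend (raise i) (⇑(f + g)) 0 p =
      Function.extend (raise i) (⇑f) 0 p + Function.extend (raise i) (⇑g) 0 p
    by_cases hp : ∃ q, raise i q = p
    · obtain ⟨q, rfl⟩ := hp
      rw [(raise_injective i).extend_apply, (raise_injective i).extend_apply,
        (raise_injective i).extend_apply]
      rfl
    · rw [Function.extend_apply' _ _ _ hp, Function.extend_apply' _ _ _ hp,
        Function.extend_apply' _ _ _ hp]
      simp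
  map_smul' c f := by
    ext p
    change Function.extend (raise i) (⇑(c • f)) 0 p =
      c • Function.extend (raise i) (⇑f) 0 p
    by_cases hp : ∃ q, raise i q = p
    · obtain ⟨q, rfl⟩ := hp
      simp [(raise_injective i).extend_apply]
    · simp [Function.extend_apply' _ _ _ hp]
  norm_map' f := by
    have h2 : 0 < (2 : ℝ≥0∞).toReal := by simp
    have h := (hasSum_extend_raise i f).tsum_eq
    have h' := lp.norm_rpow_eq_tsum h2
      (⟨Function.extend (raise i) f 0, memℓp_gen (hasSum_extend_raise i f).summable⟩ :
        HardyBidisk F)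
    exact (Real.rpow_left_inj (norm_nonneg _) (norm_nonneg _) h2.ne').mp (h'.trans h)

theorem mulCoord_raise {F : Type*} [NormedAddCommGroup F] [InnerProductSpace ℂ F] (i : Fin 2)
    (f : HardyBidisk F) (p : ℕ × ℕ) : mulCoord i f (raise i p) = f p :=
  (raise_injective i).extend_apply _ _ _

theorem mulCoord_of_not_range {F : Type*} [NormedAddCommGroup F] [InnerProductSpace ℂ F]
    (i : Fin 2) (f : HardyBidisk F) (p : ℕ × ℕ) (hp : ¬ ∃ q, raise i q = p) :
    mulCoord i f p = 0 :=
  Function.extend_apply' _ _ _ hp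

/-- On the bidisk, `mulCoord i` is pointwise multiplication: `(W_i f)(z) = z_i f(z)`. -/
theorem eval_mulCoord {F : Type*} [NormedAddCommGroup F] [InnerProductSpace ℂ F] [CompleteSpace F]
    (i : Fin 2) (f : HardyBidisk F) {z : Fin 2 → ℂ} (hz : ∀ i, ‖z i‖ < 1) :
    eval (mulCoord i f) z = z i • eval f z := by
  refine HasSum.unique (hasSum_eval _ hz) ?_
  rw [← (raise_injective i).hasSum_iff]
  · refine ((hasSum_eval f hz).const_smul (z i)).congr_fun ?_
    intro p
    simp only [Function.comp, mulCoord_raise, smul_smul]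
    congr 1
    fin_cases i <;> simp [raise] <;> ring
  · intro p hp
    rw [mulCoord_of_not_range i f p (fun ⟨q, hq⟩ => hp ⟨q, hq⟩), smul_zero]

theorem mulCoord_comm {F : Type*} [NormedAddCommGroup F] [InnerProductSpace ℂ F]
    (f : HardyBidisk F) : mulCoord 0 (mulCoord 1 f) = mulCoord 1 (mulCoord 0 f) := by
  ext p
  obtain ⟨m, n⟩ := p
  rcases m with _ | m
  · rw [mulCoord_of_not_range 0 _ _ (by simp [raise])]
    rcases n with _ | n
    · rw [mulCoord_of_not_range 1 _ _ (by simp [raise])]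
    · rw [show ((0 : ℕ), n + 1) = raise 1 (0, n) from rfl, mulCoord_raise,
        mulCoord_of_not_range 0 _ _ (by simp [raise])]
  · rw [show (m + 1, n) = raise 0 (m, n) from rfl, mulCoord_raise]
    rcases n with _ | n
    · rw [mulCoord_of_not_range 1 _ _ (by simp [raise]),
        mulCoord_of_not_range 1 _ _ (by simp [raise])]
    · rw [show (m, n + 1) = raise 1 (m, n) from rfl, mulCoord_raise,
        show raise 0 (raise 1 (m, n)) = raise 1 (raise 0 (m, n)) from rfl, mulCoord_raise,
        mulCoord_raise]

/-- The bi-isometry `W_F` of multiplications by the coordinates on `H²(𝔻²) ⊗ F`. -/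
def coordBiIsometry (F : Type*) [NormedAddCommGroup F] [InnerProductSpace ℂ F] :
    BiIsometry (HardyBidisk F) where
  op i := (mulCoord i).toContinuousLinearMap
  norm_map i f := (mulCoord i).norm_map f
  comm i j f := by
    change mulCoord i (mulCoord j f) = mulCoord j (mulCoord i f)
    fin_cases i <;> fin_cases j
    · rfl
    · exact mulCoord_comm f
    · exact (mulCoord_comm f).symm
    · rfl

end HardyBidisk

end

/-!
For commuting operators `S` and `T`, with `T` isometric, `S` commutes with `T†` exactly when `S`
leaves `ker T†` invariant, because `x - T T† x ∈ ker T†`. Hence double commutation means that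
`W_1` leaves `ker W_0†` invariant, or, equivalently, that `W_0` leaves `ker W_1†` invariant. Since
the pivotal operator is the compression of `W_0` to `ker W_1†`, and a projection preserves the norm
of a vector only if it fixes it, this is the same as the pivotal operator being isometric.
A vector of the shift space is determined by the components `P_E V_0†^k x`, so `Θ_W` is constantly
`S` if and only if `A e = S e` for `e ∈ E = ker W_0†`; for isometric `S` this again says that `W_1`
leaves `ker W_0†` invariant.

If `W` doubly commutes, the unitary part `⋂ ran W_i ^ n` of `W_i` reduces both operators, so that
purity makes both of them shifts. Then `K` is the Hilbert sum of the spaces `W_0 ^ m W_1 ^ n L` with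
`L = ker W_0† ∩ ker W_1†`, which is the identification with `H²(𝔻²) ⊗ L`.
-/

open scoped InnerProductSpace InnerProduct Topology

/-! ### Isometries and their Wold decomposition -/

section Isometry

variable {𝕜 K : Type*} [RCLike 𝕜] [NormedAddCommGroup K] [InnerProductSpace 𝕜 K]
  {S T : K →L[𝕜] K}

theorem apply_apply_of_commute (h : Commute S T) (x : K) : S (T x) = T (S x) :=
  congr($(h.eq) x)

theorem norm_pow_apply_of_norm_map (hT : ∀ x, ‖T x‖ = ‖x‖) (n : ℕ) (x : K) :
    ‖(T ^ n) x‖ = ‖x‖ := by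
  induction n with
  | zero => simp
  | succ n ih => rw [pow_succ', mul_apply_eq_comp, hT, ih]

theorem inner_pow_apply_of_norm_map (hT : ∀ x, ‖T x‖ = ‖x‖) (n : ℕ) (x y : K) :
    ⟪(T ^ n) x, (T ^ n) y⟫_𝕜 = ⟪x, y⟫_𝕜 :=
  (LinearMap.norm_map_iff_inner_map_map (T ^ n)).mp (norm_pow_apply_of_norm_map hT n) x y

/-- The space of the unitary part in the von Neumann-Wold decomposition of an isometry `T`, encoded
as the intersection of the ranges of the powers of `T`. -/
def unitaryPart (T : K →L[𝕜] K) : Submodule 𝕜 K :=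
  ⨅ n : ℕ, (T ^ n).range

theorem mem_unitaryPart {x : K} : x ∈ unitaryPart T ↔ ∀ n : ℕ, ∃ y, (T ^ n) y = x := by
  simp only [unitaryPart, Submodule.mem_iInf]
  rfl

theorem apply_mem_unitaryPart_of_commute (h : Commute S T) {x : K} (hx : x ∈ unitaryPart T) :
    S x ∈ unitaryPart T := by
  rw [mem_unitaryPart] at hx ⊢
  intro n
  obtain ⟨y, rfl⟩ := hx n
  exact ⟨S y, (apply_apply_of_commute (h.pow_right n) y).symm⟩

theorem le_unitaryPart {M : Submodule 𝕜 K} (h : ∀ y ∈ M, ∃ x ∈ M, T x = y) :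
    M ≤ unitaryPart T := by
  suffices ∀ n : ℕ, ∀ y ∈ M, ∃ x ∈ M, (T ^ n) x = y from
    fun y hy => mem_unitaryPart.mpr fun n => (this n y hy).imp fun _ hx => hx.2
  intro n
  induction n with
  | zero => exact fun y hy => ⟨y, hy, rfl⟩
  | succ n ih =>
    intro y hy
    obtain ⟨z, hz, rfl⟩ := ih y hy
    obtain ⟨x, hx, rfl⟩ := h z hz
    exact ⟨x, hx, by rw [pow_succ, mul_apply_eq_comp]⟩

variable [CompleteSpace K]

theorem adjoint_apply_apply_of_norm_map (hT : ∀ x, ‖T x‖ = ‖x‖) (x : K) : (T†) (T x) = x :=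
  congr($(T.norm_map_iff_adjoint_comp_self.mp hT) x)

theorem adjoint_pow (T : K →L[𝕜] K) (n : ℕ) : (T ^ n)† = T† ^ n :=
  star_pow T n

theorem adjoint_mem_orthogonal {M : Submodule 𝕜 K} (h : ∀ x ∈ M, T x ∈ M) {x : K} (hx : x ∈ Mᗮ) :
    (T†) x ∈ Mᗮ := by
  rw [Submodule.mem_orthogonal] at hx ⊢
  intro u hu
  rw [ContinuousLinearMap.adjoint_inner_right, hx _ (h u hu)]

theorem starProjection_ker_adjoint (hT : ∀ x, ‖T x‖ = ‖x‖) :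
    (T†).ker.starProjection = 1 - T * T† := by
  ext x
  refine Submodule.eq_starProjection_of_mem_of_inner_eq_zero (K := (T†).ker) ?_ fun y hy => ?_
  · change (T†) (x - T ((T†) x)) = 0
    rw [map_sub, adjoint_apply_apply_of_norm_map hT, sub_self]
  · change ⟪x - (x - T ((T†) x)), y⟫_𝕜 = 0
    have hy : (T†) y = 0 := hy
    rw [sub_sub_cancel, ← ContinuousLinearMap.adjoint_inner_right, hy, inner_zero_right]

theorem commute_starProjection_ker_adjoint (hT : ∀ x, ‖T x‖ = ‖x‖) (h : Commute S T)
    (h' : Commute S (T†)) : Commute S (T†).ker.starProjection := by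
  rw [starProjection_ker_adjoint hT]
  exact (Commute.one_right S).sub_right (h.mul_right h')

theorem mem_orthogonal_ker_adjoint_iff (hT : ∀ x, ‖T x‖ = ‖x‖) {x : K} :
    x ∈ (T†).kerᗮ ↔ T ((T†) x) = x := by
  rw [← Submodule.starProjection_apply_eq_zero_iff, starProjection_ker_adjoint hT]
  exact sub_eq_zero.trans eq_comm

theorem commute_adjoint_iff_apply_mem_ker (hT : ∀ x, ‖T x‖ = ‖x‖) (h : Commute S T) :
    Commute S (T†) ↔ ∀ x, (T†) x = 0 → (T†) (S x) = 0 := by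
  refine ⟨fun h' x hx => by rw [← apply_apply_of_commute h', hx, map_zero], fun h' => ?_⟩
  ext x
  have hker : (T†) (x - T ((T†) x)) = 0 := by
    rw [map_sub, adjoint_apply_apply_of_norm_map hT, sub_self]
  have hS : (T†) (S x) - S ((T†) x) = 0 := by
    simpa only [map_sub, apply_apply_of_commute h, adjoint_apply_apply_of_norm_map hT]
      using h' _ hker
  exact (sub_eq_zero.mp hS).symm

theorem inner_pow_apply_eq_zero_of_mem_unitaryPart (hT : ∀ x, ‖T x‖ = ‖x‖) {x y : K}
    (hx : x ∈ unitaryPart T) (hy : (T†) y = 0) (n : ℕ) : ⟪(T ^ n) y, x⟫_𝕜 = 0 := by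
  obtain ⟨z, rfl⟩ := mem_unitaryPart.mp hx (n + 1)
  rw [pow_succ, mul_apply_eq_comp, inner_pow_apply_of_norm_map hT,
    ← ContinuousLinearMap.adjoint_inner_left, hy, inner_zero_left]

theorem mem_unitaryPart_iff_inner (hT : ∀ x, ‖T x‖ = ‖x‖) {x : K} :
    x ∈ unitaryPart T ↔ ∀ (n : ℕ) (y : K), (T†) y = 0 → ⟪(T ^ n) y, x⟫_𝕜 = 0 := by
  refine ⟨fun hx n y hy => inner_pow_apply_eq_zero_of_mem_unitaryPart hT hx hy n,
    fun h => mem_unitaryPart.mpr fun n => ?_⟩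
  induction n with
  | zero => exact ⟨x, rfl⟩
  | succ n ih =>
    obtain ⟨z, rfl⟩ := ih
    have hz : z ∈ (T†).kerᗮ := (Submodule.mem_orthogonal _ _).mpr fun y hy => by
      rw [← inner_pow_apply_of_norm_map hT n]
      exact h n y hy
    refine ⟨(T†) z, ?_⟩
    rw [pow_succ, mul_apply_eq_comp,
      (mem_orthogonal_ker_adjoint_iff hT).mp hz]

theorem orthogonal_iSup_map_pow_ker_adjoint (hT : ∀ x, ‖T x‖ = ‖x‖) :
    (⨆ n : ℕ, (T†).ker.map ((T ^ n : K →L[𝕜] K) : K →ₗ[𝕜] K))ᗮ = unitaryPart T := by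
  ext x
  rw [← Submodule.iInf_orthogonal, Submodule.mem_iInf, mem_unitaryPart_iff_inner hT]
  simp only [Submodule.mem_orthogonal, Submodule.mem_map, forall_exists_index, and_imp,
    forall_apply_eq_imp_iff₂]
  rfl

theorem isClosed_unitaryPart (hT : ∀ x, ‖T x‖ = ‖x‖) : IsClosed (unitaryPart T : Set K) := by
  rw [← orthogonal_iSup_map_pow_ker_adjoint hT]
  exact Submodule.isClosed_orthogonal _

theorem apply_adjoint_of_mem_unitaryPart (hT : ∀ x, ‖T x‖ = ‖x‖) {x : K}
    (hx : x ∈ unitaryPart T) : T ((T†) x) = x := by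
  obtain ⟨y, rfl⟩ : ∃ y, T y = x := by simpa using mem_unitaryPart.mp hx 1
  rw [adjoint_apply_apply_of_norm_map hT]

theorem adjoint_mem_unitaryPart (hT : ∀ x, ‖T x‖ = ‖x‖) {x : K} (hx : x ∈ unitaryPart T) :
    (T†) x ∈ unitaryPart T := by
  rw [mem_unitaryPart] at hx ⊢
  intro n
  obtain ⟨y, rfl⟩ := hx (n + 1)
  refine ⟨y, ?_⟩
  rw [pow_succ', mul_apply_eq_comp, adjoint_apply_apply_of_norm_map hT]

theorem inner_pow_pow_eq_zero (hT : ∀ x, ‖T x‖ = ‖x‖) {m n : ℕ} (hmn : m ≠ n) {x y : K}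
    (hx : (T†) x = 0) (hy : (T†) y = 0) : ⟪(T ^ m) x, (T ^ n) y⟫_𝕜 = 0 := by
  wlog h : m < n generalizing m n x y
  · exact inner_eq_zero_symm.mp (this hmn.symm hy hx (by lia))
  obtain ⟨k, rfl⟩ := Nat.exists_eq_add_of_lt h
  rw [add_assoc, pow_add, mul_apply_eq_comp, inner_pow_apply_of_norm_map hT,
    pow_succ', mul_apply_eq_comp, ← ContinuousLinearMap.adjoint_inner_left, hx,
    inner_zero_left]

end Isometry

section Intertwining

variable {𝕜 K K' : Type*} [RCLike 𝕜] [NormedAddCommGroup K] [InnerProductSpace 𝕜 K]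
  [NormedAddCommGroup K'] [InnerProductSpace 𝕜 K'] {T : K →L[𝕜] K} {T' : K' →L[𝕜] K'}

theorem map_mem_unitaryPart_of_semiconj {U : K →L[𝕜] K'} (h : Function.Semiconj U T T') {x : K}
    (hx : x ∈ unitaryPart T) : U x ∈ unitaryPart T' := by
  rw [mem_unitaryPart] at hx ⊢
  intro n
  obtain ⟨y, rfl⟩ := hx n
  refine ⟨U y, ?_⟩
  simpa only [FunLike.coe_pow_eq_iterate] using ((h.iterate_right n) y).symm

theorem semiconj_adjoint [CompleteSpace K] [CompleteSpace K'] {U : K ≃ₗᵢ[𝕜] K'}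
    (h : Function.Semiconj U T T') : Function.Semiconj U (T†) (T'†) := by
  intro x
  refine ext_inner_right 𝕜 fun y => ?_
  obtain ⟨y, rfl⟩ := U.surjective y
  rw [ContinuousLinearMap.adjoint_inner_left, ← h, U.inner_map_map, U.inner_map_map,
    ContinuousLinearMap.adjoint_inner_left]

end Intertwining

theorem isReducing_of_adjoint_mem {ι K : Type*} [NormedAddCommGroup K] [InnerProductSpace ℂ K]
    [CompleteSpace K] {V : ι → K →L[ℂ] K} {M : Submodule ℂ K} (h : ∀ i, ∀ x ∈ M, V i x ∈ M)
    (h' : ∀ i, ∀ x ∈ M, ((V i)†) x ∈ M) : IsReducing V M := by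
  refine fun i => ⟨h i, fun x hx => ?_⟩
  rw [← ContinuousLinearMap.adjoint_adjoint (V i)]
  exact adjoint_mem_orthogonal (h' i) hx

/-! ### Coefficients of power series -/

theorem coeff_eq_of_hasSum_pow_smul {𝕜 E : Type*} [NontriviallyNormedField 𝕜]
    [NormedAddCommGroup E] [NormedSpace 𝕜 E] {a b : ℕ → E} {f : 𝕜 → E}
    (ha : ∀ᶠ z in 𝓝 (0 : 𝕜), HasSum (fun k => z ^ k • a k) (f z))
    (hb : ∀ᶠ z in 𝓝 (0 : 𝕜), HasSum (fun k => z ^ k • b k) (f z)) : a = b := by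
  have hasFPowerSeriesAt (c : ℕ → E) (hc : ∀ᶠ z in 𝓝 (0 : 𝕜), HasSum (fun k => z ^ k • c k) (f z)) :
      HasFPowerSeriesAt f (show FormalMultilinearSeries 𝕜 𝕜 E from
        fun n => ContinuousMultilinearMap.mkPiRing 𝕜 (Fin n) (c n)) 0 := by
    rw [hasFPowerSeriesAt_iff]
    filter_upwards [hc] with z hz
    simpa [FormalMultilinearSeries.coeff] using hz
  have h := (hasFPowerSeriesAt a ha).eq_formalMultilinearSeries (hasFPowerSeriesAt b hb)
  funext n
  simpa using congr($h n fun _ => 1)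

theorem hasSum_pow_smul_single_zero {R E : Type*} [Semiring R] [AddCommMonoid E] [Module R E]
    [TopologicalSpace E] (a : E) (z : R) :
    HasSum (fun k => z ^ k • (Pi.single 0 a : ℕ → E) k) a := by
  have h := hasSum_single (f := fun k => z ^ k • (Pi.single 0 a : ℕ → E) k) 0 fun k hk => by
    simp [hk]
  simpa using h

theorem operatorSeries_eq_const_iff {E : Type*} [NormedAddCommGroup E] [InnerProductSpace ℂ E]
    [CompleteSpace E] {T : ℕ → E →L[ℂ] E} {C : ℝ} (hT : ∀ k, ‖T k‖ ≤ C) {S : E →L[ℂ] E} :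
    (∀ z : ℂ, ‖z‖ < 1 → operatorSeries T z = S) ↔ T = Pi.single 0 S := by
  constructor
  · intro h
    refine coeff_eq_of_hasSum_pow_smul (𝕜 := ℂ) (f := fun _ => S) ?_
      (.of_forall (hasSum_pow_smul_single_zero S))
    filter_upwards [Metric.ball_mem_nhds (0 : ℂ) one_pos] with z hz
    rw [mem_ball_zero_iff] at hz
    exact h z hz ▸ hasSum_operatorSeries T hT hz
  · rintro rfl z -
    exact (hasSum_pow_smul_single_zero S z).tsum_eq

/-! ### Coefficients of a pair with a pure isometry -/

section Pair

variable {H : Type*} [NormedAddCommGroup H] [InnerProductSpace ℂ H] [CompleteSpace H]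
  {V A : H →L[ℂ] H}

theorem wanderingSpace_eq_ker_adjoint (V : H →L[ℂ] H) : wanderingSpace V = (V†).ker :=
  V.orthogonal_range

theorem mem_wanderingSpace_iff {x : H} : x ∈ wanderingSpace V ↔ (V†) x = 0 := by
  rw [wanderingSpace_eq_ker_adjoint]
  rfl

theorem orthogonalProjectionOnto_adjoint_pow_wandering (e : wanderingSpace V) (n : ℕ) :
    (wanderingSpace V).orthogonalProjectionOnto ((V† ^ n) (e : H)) =
      (Pi.single 0 e : ℕ → wanderingSpace V) n := by
  cases n with
  | zero => simp
  | succ n =>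
    rw [pow_succ, mul_apply_eq_comp, mem_wanderingSpace_iff.mp e.2,
      Pi.single_eq_of_ne n.succ_ne_zero, map_zero, map_zero]

theorem ext_orthogonalProjectionOnto_adjoint_pow (hV : ∀ x, ‖V x‖ = ‖x‖)
    (hpure : unitaryPart V = ⊥) {x y : H}
    (h : ∀ n : ℕ, (wanderingSpace V).orthogonalProjectionOnto ((V† ^ n) x) =
      (wanderingSpace V).orthogonalProjectionOnto ((V† ^ n) y)) : x = y := by
  have hmem : x - y ∈ unitaryPart V := (mem_unitaryPart_iff_inner hV).mpr fun n e he => by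
    have hzero : (wanderingSpace V).orthogonalProjectionOnto ((V† ^ n) (x - y)) = 0 := by
      rw [map_sub, map_sub, h, sub_self]
    rw [← ContinuousLinearMap.adjoint_inner_right, adjoint_pow]
    exact Submodule.orthogonalProjectionOnto_eq_zero_iff.mp hzero e (mem_wanderingSpace_iff.mpr he)
  rwa [hpure, Submodule.mem_bot, sub_eq_zero] at hmem

theorem pairCoeff_eq_single_zero_iff (hV : ∀ x, ‖V x‖ = ‖x‖) (hpure : unitaryPart V = ⊥)
    {S : wanderingSpace V →L[ℂ] wanderingSpace V} :
    pairCoeff V A = Pi.single 0 S ↔ ∀ e : wanderingSpace V, A e = S e := by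
  have single_apply (n : ℕ) (e : wanderingSpace V) :
      (Pi.single 0 S : ℕ → wanderingSpace V →L[ℂ] wanderingSpace V) n e =
        (wanderingSpace V).orthogonalProjectionOnto ((V† ^ n) (S e : H)) := by
    rw [orthogonalProjectionOnto_adjoint_pow_wandering]
    exact Pi.apply_single (fun _ (R : wanderingSpace V →L[ℂ] wanderingSpace V) => R e)
      (fun _ => rfl) 0 S n
  constructor
  · intro h e
    refine ext_orthogonalProjectionOnto_adjoint_pow hV hpure fun n => ?_
    rw [← single_apply, ← h]
    rfl
  · intro h
    ext n e : 2
    rw [single_apply, ← h]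
    rfl

end Pair

namespace BiIsometry

section

variable {K : Type*} [NormedAddCommGroup K] [InnerProductSpace ℂ K] {W : BiIsometry K}

theorem commute_op (W : BiIsometry K) (i j : Fin 2) : Commute (W.op i) (W.op j) :=
  ContinuousLinearMap.ext (W.comm i j)

theorem isPure_singleton_of_unitaryPart_eq_bot {i : Fin 2} (h : unitaryPart (W.op i) = ⊥) :
    W.IsPure {i} :=
  fun _ _ _ hM => eq_bot_mono (le_unitaryPart (hM i rfl).2.2) h

variable [CompleteSpace K]

/-! ### Double commutation and the pivotal operator -/

theorem doublyCommuting_iff :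
    W.DoublyCommuting ↔ ∀ x, ((W.op 1)†) x = 0 → ((W.op 1)†) (W.op 0 x) = 0 :=
  commute_adjoint_iff_apply_mem_ker (W.norm_map 1) (W.commute_op 0 1)

theorem doublyCommuting_swap_iff : W.swap.DoublyCommuting ↔ W.DoublyCommuting :=
  calc Commute (W.op 1) ((W.op 0)†)
    _ ↔ Commute ((W.op 1)†) (W.op 0) := commute_star_comm.symm
    _ ↔ Commute (W.op 0) ((W.op 1)†) := Commute.symm_iff

theorem DoublyCommuting.commute_op_adjoint (h : W.DoublyCommuting) {i j : Fin 2} (hij : i ≠ j) :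
    Commute (W.op i) ((W.op j)†) := by
  fin_cases i <;> fin_cases j
  · exact absurd rfl hij
  · exact h
  · exact doublyCommuting_swap_iff.mpr h
  · exact absurd rfl hij

theorem coe_pivotalOperator (W : BiIsometry K) (x : ((W.op 1)†).ker) :
    (W.pivotalOperator x : K) = ((W.op 1)†).ker.starProjection (W.op 0 x) := by
  symm
  refine Submodule.eq_starProjection_of_mem_of_inner_eq_zero (Subtype.mem _) fun y hy => ?_
  have hinner : ⟪(W.pivotalOperator x : K), y⟫_ℂ = ⟪(x : K), ((W.op 0)†) y⟫_ℂ :=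
    ContinuousLinearMap.adjoint_inner_left
      (((W.op 0)†).restrict fun _ hx => W.adjoint_mem_ker hx) ⟨y, hy⟩ x
  rw [inner_sub_left, hinner, ContinuousLinearMap.adjoint_inner_right, sub_self]

theorem isometry_pivotalOperator_iff : Isometry W.pivotalOperator ↔ W.DoublyCommuting := by
  rw [AddMonoidHomClass.isometry_iff_norm, doublyCommuting_iff, Subtype.forall]
  refine forall₂_congr fun x hx => ?_
  rw [Submodule.coe_norm, coe_pivotalOperator, Submodule.coe_norm, ← W.norm_map 0 (Subtype.val _)]
  exact (Submodule.mem_iff_norm_starProjection ((W.op 1)†).ker (W.op 0 x)).symm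

/-! ### The characteristic function -/

theorem orthogonal_shiftSpace (W : BiIsometry K) : W.shiftSpaceᗮ = unitaryPart (W.op 0) := by
  rw [shiftSpace, Submodule.orthogonal_closure, wanderingSpace_eq_ker_adjoint,
    orthogonal_iSup_map_pow_ker_adjoint (W.norm_map 0)]

theorem orthogonal_unitaryPart (W : BiIsometry K) : (unitaryPart (W.op 0))ᗮ = W.shiftSpace := by
  rw [← orthogonal_shiftSpace, Submodule.orthogonal_orthogonal]

theorem mem_shiftSpace_of_adjoint_eq_zero (W : BiIsometry K) {x : K} (hx : ((W.op 0)†) x = 0) :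
    x ∈ W.shiftSpace := by
  rw [← orthogonal_unitaryPart, Submodule.mem_orthogonal']
  exact fun u hu => by simpa using inner_pow_apply_eq_zero_of_mem_unitaryPart (W.norm_map 0) hu hx 0

theorem adjoint_mem_shiftSpace (W : BiIsometry K) {x : K} (hx : x ∈ W.shiftSpace) :
    ((W.op 0)†) x ∈ W.shiftSpace := by
  rw [← orthogonal_unitaryPart] at hx ⊢
  exact adjoint_mem_orthogonal
    (fun _ hu => apply_mem_unitaryPart_of_commute (Commute.refl _) hu) hx

theorem coe_adjoint_charShift (W : BiIsometry K) (x : W.shiftSpace) :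
    ((W.charShift†) x : K) = ((W.op 0)†) x := by
  suffices (W.charShift†) x = ⟨((W.op 0)†) x, W.adjoint_mem_shiftSpace x.2⟩ by rw [this]
  refine ext_inner_right ℂ fun y => ?_
  rw [ContinuousLinearMap.adjoint_inner_left]
  exact (ContinuousLinearMap.adjoint_inner_left (W.op 0) (y : K) x).symm

theorem mem_wanderingSpace_charShift_iff {x : W.shiftSpace} :
    x ∈ wanderingSpace W.charShift ↔ ((W.op 0)†) (x : K) = 0 := by
  rw [mem_wanderingSpace_iff, ← coe_adjoint_charShift, Submodule.coe_eq_zero]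

theorem unitaryPart_charShift (W : BiIsometry K) : unitaryPart W.charShift = ⊥ := by
  refine (Submodule.eq_bot_iff _).mpr fun x hx => Subtype.ext ?_
  have hx' : (x : K) ∈ W.shiftSpaceᗮ := by
    rw [orthogonal_shiftSpace]
    exact map_mem_unitaryPart_of_semiconj (U := W.shiftSpace.subtypeL) (fun _ => rfl) hx
  exact Submodule.disjoint_def.mp W.shiftSpace.orthogonal_disjoint x x.2 hx'

theorem charFunction_eq_const_iff
    {S : wanderingSpace W.charShift →L[ℂ] wanderingSpace W.charShift} :
    (∀ z : ℂ, ‖z‖ < 1 → W.charFunction z = S) ↔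
      ∀ e : wanderingSpace W.charShift, W.charContraction e = S e :=
  (operatorSeries_eq_const_iff W.norm_charCoeff_le).trans
    (pairCoeff_eq_single_zero_iff (V := W.charShift) (fun x => W.norm_map 0 x)
      W.unitaryPart_charShift)

theorem coe_charContraction_of_mem {x : W.shiftSpace} (h : W.op 1 x ∈ W.shiftSpace) :
    (W.charContraction x : K) = W.op 1 x :=
  Submodule.starProjection_eq_self_iff.mpr h

theorem op_mem_shiftSpace_of_norm_charContraction_eq {x : W.shiftSpace}
    (h : ‖W.charContraction x‖ = ‖x‖) : W.op 1 x ∈ W.shiftSpace := by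
  rw [Submodule.mem_iff_norm_starProjection, W.norm_map]
  exact h

theorem adjoint_op_eq_zero_of_charFunction_eq_const
    {S : wanderingSpace W.charShift →L[ℂ] wanderingSpace W.charShift} (hS : Isometry S)
    (hΘ : ∀ z : ℂ, ‖z‖ < 1 → W.charFunction z = S) {x : K} (hx : ((W.op 0)†) x = 0) :
    ((W.op 0)†) (W.op 1 x) = 0 := by
  let e : wanderingSpace W.charShift :=
    ⟨⟨x, W.mem_shiftSpace_of_adjoint_eq_zero hx⟩, mem_wanderingSpace_charShift_iff.mpr hx⟩
  have hAe : W.charContraction e = S e := charFunction_eq_const_iff.mp hΘ e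
  have hnorm : ‖W.charContraction e‖ = ‖(e : W.shiftSpace)‖ := by
    rw [hAe]
    exact (AddMonoidHomClass.isometry_iff_norm S).mp hS e
  have hop : W.op 1 x = (S e : W.shiftSpace) := by
    rw [← hAe, coe_charContraction_of_mem (op_mem_shiftSpace_of_norm_charContraction_eq hnorm)]
  rw [hop]
  exact mem_wanderingSpace_charShift_iff.mp (S e).2

theorem charFunctionIsConstantIsometry_of_adjoint_op_eq_zero
    (h : ∀ x, ((W.op 0)†) x = 0 → ((W.op 0)†) (W.op 1 x) = 0) :
    W.CharFunctionIsConstantIsometry := by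
  have hker (e : wanderingSpace W.charShift) : ((W.op 0)†) (W.op 1 (e : W.shiftSpace)) = 0 :=
    h _ (mem_wanderingSpace_charShift_iff.mp e.2)
  have hA (e : wanderingSpace W.charShift) :
      (W.charContraction e : K) = W.op 1 (e : W.shiftSpace) :=
    coe_charContraction_of_mem (W.mem_shiftSpace_of_adjoint_eq_zero (hker e))
  have hmaps : ∀ x ∈ wanderingSpace W.charShift,
      W.charContraction x ∈ wanderingSpace W.charShift := fun x hx => by
    rw [mem_wanderingSpace_charShift_iff, hA ⟨x, hx⟩]
    exact hker ⟨x, hx⟩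
  refine ⟨W.charContraction.restrict hmaps, ?_, charFunction_eq_const_iff.mpr fun _ => rfl⟩
  exact (AddMonoidHomClass.isometry_iff_norm _).mpr fun e =>
    (congrArg norm (hA e)).trans (W.norm_map 1 _)

theorem charFunctionIsConstantIsometry_iff :
    W.CharFunctionIsConstantIsometry ↔ W.DoublyCommuting := by
  rw [← doublyCommuting_swap_iff, doublyCommuting_iff]
  exact ⟨fun ⟨_, hS, hΘ⟩ _ hx => adjoint_op_eq_zero_of_charFunction_eq_const hS hΘ hx,
    charFunctionIsConstantIsometry_of_adjoint_op_eq_zero⟩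

/-! ### The Wold decomposition of a doubly commuting bi-isometry -/

theorem DoublyCommuting.unitaryPart_eq_bot (h : W.DoublyCommuting) {i : Fin 2}
    (hpure : W.IsPure {i}) : unitaryPart (W.op i) = ⊥ := by
  have op_mem (j : Fin 2) (x : K) (hx : x ∈ unitaryPart (W.op i)) :
      W.op j x ∈ unitaryPart (W.op i) :=
    apply_mem_unitaryPart_of_commute (W.commute_op j i) hx
  have adjoint_mem (j : Fin 2) (x : K) (hx : x ∈ unitaryPart (W.op i)) :
      ((W.op j)†) x ∈ unitaryPart (W.op i) := by
    rcases eq_or_ne i j with rfl | hij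
    · exact adjoint_mem_unitaryPart (W.norm_map i) hx
    · exact apply_mem_unitaryPart_of_commute (h.commute_op_adjoint hij).symm hx
  refine hpure _ (isClosed_unitaryPart (W.norm_map i))
    (isReducing_of_adjoint_mem op_mem adjoint_mem) fun j hj => ?_
  obtain rfl : j = i := hj
  exact ⟨op_mem j, fun x _ => W.norm_map j x,
    fun y hy => ⟨_, adjoint_mem j y hy, apply_adjoint_of_mem_unitaryPart (W.norm_map j) hy⟩⟩

/-- The joint wandering subspace `ker W_0* ∩ ker W_1*`, which serves as the coefficient space when
`W` is identified with the coordinate multiplications on the bidisk. -/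
noncomputable def jointWanderingSpace (W : BiIsometry K) : Submodule ℂ K :=
  ((W.op 0)†).ker ⊓ ((W.op 1)†).ker

instance jointWanderingSpace.completeSpace (W : BiIsometry K) :
    CompleteSpace W.jointWanderingSpace :=
  (((W.op 0)†).isClosed_ker.inter ((W.op 1)†).isClosed_ker).completeSpace_coe

/-- The isometry `W_0 ^ m W_1 ^ n` from the joint wandering subspace to the whole space, for
`p = (m, n)`; it is the counterpart of the embedding `a ↦ z_0 ^ m z_1 ^ n a` into the Hardy
space. -/
noncomputable def monomialIsometry (W : BiIsometry K) (p : ℕ × ℕ) :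
    W.jointWanderingSpace →ₗᵢ[ℂ] K where
  toLinearMap := ((W.op 0 ^ p.1 * W.op 1 ^ p.2 : K →L[ℂ] K) : K →ₗ[ℂ] K) ∘ₗ
    W.jointWanderingSpace.subtype
  norm_map' _ := (norm_pow_apply_of_norm_map (W.norm_map 0) _ _).trans
    (norm_pow_apply_of_norm_map (W.norm_map 1) _ _)

theorem monomialIsometry_apply (W : BiIsometry K) (p : ℕ × ℕ) (x : W.jointWanderingSpace) :
    W.monomialIsometry p x = (W.op 0 ^ p.1) ((W.op 1 ^ p.2) x) :=
  rfl

theorem op_monomialIsometry (W : BiIsometry K) (i : Fin 2) (p : ℕ × ℕ)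
    (x : W.jointWanderingSpace) :
    W.op i (W.monomialIsometry p x) = W.monomialIsometry (HardyBidisk.raise i p) x := by
  rw [monomialIsometry_apply, monomialIsometry_apply]
  fin_cases i
  · change W.op 0 _ = (W.op 0 ^ (p.1 + 1)) _
    rw [pow_succ', mul_apply_eq_comp]
    rfl
  · change W.op 1 _ = (W.op 0 ^ p.1) ((W.op 1 ^ (p.2 + 1)) x)
    rw [apply_apply_of_commute ((W.commute_op 1 0).pow_right p.1), pow_succ', mul_apply_eq_comp]

theorem DoublyCommuting.orthogonalFamily (h : W.DoublyCommuting) :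
    OrthogonalFamily ℂ (fun _ : ℕ × ℕ => W.jointWanderingSpace) W.monomialIsometry := by
  rintro ⟨m, n⟩ ⟨m', n'⟩ hne x y
  have adjoint_pow_eq_zero (k : ℕ) (u : W.jointWanderingSpace) :
      ((W.op 0)†) ((W.op 1 ^ k) u) = 0 := by
    have hu : ((W.op 0)†) (u : K) = 0 := u.2.1
    rw [← apply_apply_of_commute ((h.commute_op_adjoint one_ne_zero).pow_left k), hu, map_zero]
  rw [monomialIsometry_apply, monomialIsometry_apply]
  rcases eq_or_ne m m' with rfl | hm
  · rw [inner_pow_apply_of_norm_map (W.norm_map 0)]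
    exact inner_pow_pow_eq_zero (W.norm_map 1) (by rintro rfl; exact hne rfl) x.2.2 y.2.2
  · exact inner_pow_pow_eq_zero (W.norm_map 0) hm (adjoint_pow_eq_zero n x)
      (adjoint_pow_eq_zero n' y)

theorem DoublyCommuting.starProjection_mem_jointWanderingSpace (h : W.DoublyCommuting) {v : K}
    (hv : ((W.op 1)†) v = 0) : ((W.op 0)†).ker.starProjection v ∈ W.jointWanderingSpace := by
  have hcomm : Commute ((W.op 1)†) ((W.op 0)†).ker.starProjection :=
    commute_starProjection_ker_adjoint (W.norm_map 0) (h.commute_op_adjoint zero_ne_one).symm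
      (W.commute_op 1 0).star_star
  refine ⟨Submodule.starProjection_apply_mem _ _, ?_⟩
  change ((W.op 1)†) _ = 0
  rw [apply_apply_of_commute hcomm, hv, map_zero]

theorem DoublyCommuting.eq_zero_of_orthogonal_monomialIsometry (h : W.DoublyCommuting)
    (h0 : unitaryPart (W.op 0) = ⊥) (h1 : unitaryPart (W.op 1) = ⊥) {x : K}
    (hx : ∀ p u, ⟪W.monomialIsometry p u, x⟫_ℂ = 0) : x = 0 := by
  have hcomm : Commute (W.op 1) ((W.op 0)†).ker.starProjection :=
    commute_starProjection_ker_adjoint (W.norm_map 0) (W.commute_op 1 0)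
      (h.commute_op_adjoint one_ne_zero)
  set P := ((W.op 0)†).ker.starProjection with hP
  have hmem (m : ℕ) : P (((W.op 0 ^ m)†) x) ∈ unitaryPart (W.op 1) :=
    (mem_unitaryPart_iff_inner (W.norm_map 1)).mpr fun n v hv => calc
      ⟪(W.op 1 ^ n) v, P (((W.op 0 ^ m)†) x)⟫_ℂ = ⟪(W.op 0 ^ m) (P ((W.op 1 ^ n) v)), x⟫_ℂ := by
        rw [hP, ← Submodule.inner_starProjection_left_eq_right,
          ContinuousLinearMap.adjoint_inner_right]
      _ = ⟪(W.op 0 ^ m) ((W.op 1 ^ n) (P v)), x⟫_ℂ := by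
        rw [apply_apply_of_commute (hcomm.pow_left n)]
      _ = 0 := hx (m, n) ⟨P v, h.starProjection_mem_jointWanderingSpace hv⟩
  rw [← Submodule.mem_bot ℂ, ← h0, mem_unitaryPart_iff_inner (W.norm_map 0)]
  intro m w hw
  have hPw : P w = w := Submodule.starProjection_eq_self_iff.mpr hw
  have hzero : P (((W.op 0 ^ m)†) x) = 0 := (Submodule.eq_bot_iff _).mp h1 _ (hmem m)
  rw [← ContinuousLinearMap.adjoint_inner_right, ← hPw, hP,
    Submodule.inner_starProjection_left_eq_right, ← hP, hzero, inner_zero_right]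

theorem DoublyCommuting.isHilbertSum (h : W.DoublyCommuting) (h0 : unitaryPart (W.op 0) = ⊥)
    (h1 : unitaryPart (W.op 1) = ⊥) :
    IsHilbertSum ℂ (fun _ : ℕ × ℕ => W.jointWanderingSpace) W.monomialIsometry := by
  refine IsHilbertSum.mk h.orthogonalFamily ?_
  rw [top_le_iff, Submodule.topologicalClosure_eq_top_iff, Submodule.eq_bot_iff]
  exact fun x hx => h.eq_zero_of_orthogonal_monomialIsometry h0 h1 fun p u =>
    (Submodule.mem_orthogonal _ _).mp hx _ (Submodule.mem_iSup_of_mem p ⟨u, rfl⟩)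

theorem unitarilyEquivalent_coordBiIsometry
    (h : IsHilbertSum ℂ (fun _ : ℕ × ℕ => W.jointWanderingSpace) W.monomialIsometry) :
    W.UnitarilyEquivalent (HardyBidisk.coordBiIsometry W.jointWanderingSpace) := by
  let Φ := h.linearIsometryEquiv
  have symm_mulCoord (i : Fin 2) (f : HardyBidisk W.jointWanderingSpace) :
      Φ.symm (HardyBidisk.mulCoord i f) = W.op i (Φ.symm f) := by
    refine (h.hasSum_linearIsometryEquiv_symm _).unique ?_
    rw [← (HardyBidisk.raise_injective i).hasSum_iff]
    · refine ((W.op i).hasSum (h.hasSum_linearIsometryEquiv_symm f)).congr_fun fun p => ?_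
      simp only [Function.comp, HardyBidisk.mulCoord_raise, op_monomialIsometry]
    · intro p hp
      rw [HardyBidisk.mulCoord_of_not_range i f p (fun ⟨q, hq⟩ => hp ⟨q, hq⟩), map_zero]
  refine ⟨Φ, fun i x => Φ.symm.injective ?_⟩
  rw [Φ.symm_apply_apply]
  exact ((symm_mulCoord i (Φ x)).trans (by rw [Φ.symm_apply_apply])).symm

end

/-! ### Unitary invariance -/

section

variable {K K' : Type*} [NormedAddCommGroup K] [InnerProductSpace ℂ K] [NormedAddCommGroup K']
  [InnerProductSpace ℂ K'] {W : BiIsometry K} {W' : BiIsometry K'}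

theorem UnitarilyEquivalent.unitaryPart_eq_bot (hW : W.UnitarilyEquivalent W') {i : Fin 2}
    (h : unitaryPart (W'.op i) = ⊥) : unitaryPart (W.op i) = ⊥ := by
  obtain ⟨U, hU⟩ := hW
  rw [Submodule.eq_bot_iff] at h ⊢
  exact fun x hx => U.map_eq_zero_iff.mp <| h _ <|
    map_mem_unitaryPart_of_semiconj (U := (U.toContinuousLinearEquiv : K →L[ℂ] K')) (hU i) hx

theorem UnitarilyEquivalent.doublyCommuting [CompleteSpace K] [CompleteSpace K']
    (hW : W.UnitarilyEquivalent W') (h : W'.DoublyCommuting) : W.DoublyCommuting := by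
  obtain ⟨U, hU⟩ := hW
  ext x
  have h' : W'.op 0 (((W'.op 1)†) (U x)) = ((W'.op 1)†) (W'.op 0 (U x)) :=
    apply_apply_of_commute h (U x)
  apply U.injective
  simp only [ContinuousLinearMap.comp_apply]
  rw [hU, semiconj_adjoint (hU 1) x, h', ← hU, semiconj_adjoint (hU 1)]

end

end BiIsometry

/-! ### Coordinate multiplications on the Hardy space -/

namespace HardyBidisk

theorem raise_induction (i : Fin 2) {P : ℕ × ℕ → Prop}
    (not_range : ∀ p, (¬ ∃ q, raise i q = p) → P p) (map_raise : ∀ q, P q → P (raise i q))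
    (p : ℕ × ℕ) : P p := by
  by_cases hp : ∃ q, raise i q = p
  · obtain ⟨q, hq⟩ := hp
    have : q.1 + q.2 < p.1 + p.2 := by
      rw [← hq, raise]
      split_ifs <;> lia
    exact hq ▸ map_raise q (raise_induction i not_range map_raise q)
  · exact not_range p hp
termination_by p.1 + p.2

variable {F : Type*} [NormedAddCommGroup F] [InnerProductSpace ℂ F]

theorem mulCoord_single (i : Fin 2) (p : ℕ × ℕ) (a : F) :
    mulCoord i (lp.single 2 p a : HardyBidisk F) = lp.single 2 (raise i p) a := by
  ext q
  by_cases hq : ∃ r, raise i r = q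
  · obtain ⟨r, rfl⟩ := hq
    simp only [mulCoord_raise, lp.coeFn_single, Pi.single_apply, (raise_injective i).eq_iff]
  · rw [mulCoord_of_not_range i _ _ hq, lp.coeFn_single, Pi.single_eq_of_ne]
    rintro rfl
    exact hq ⟨p, rfl⟩

variable [CompleteSpace F]

theorem adjoint_mulCoord_apply (i : Fin 2) (f : HardyBidisk F) (p : ℕ × ℕ) :
    (((coordBiIsometry F).op i)†) f p = f (raise i p) := by
  refine ext_inner_right ℂ fun a => ?_
  rw [← lp.inner_single_right, ContinuousLinearMap.adjoint_inner_left]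
  change ⟪f, mulCoord i (lp.single 2 p a)⟫_ℂ = _
  rw [mulCoord_single, lp.inner_single_right]

variable (F)

theorem doublyCommuting_coordBiIsometry : (coordBiIsometry F).DoublyCommuting := by
  refine BiIsometry.doublyCommuting_iff.mpr fun f hf => ?_
  ext ⟨m, n⟩
  rw [adjoint_mulCoord_apply]
  change mulCoord 0 f (raise 1 (m, n)) = 0
  cases m with
  | zero => exact mulCoord_of_not_range 0 f _ (by simp [raise])
  | succ m =>
    calc mulCoord 0 f (raise 0 (raise 1 (m, n)))
      _ = (((coordBiIsometry F).op 1)†) f (m, n) := by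
        rw [mulCoord_raise, adjoint_mulCoord_apply]
      _ = 0 := by rw [hf]; rfl

theorem unitaryPart_coordBiIsometry (i : Fin 2) : unitaryPart ((coordBiIsometry F).op i) = ⊥ := by
  refine (Submodule.eq_bot_iff _).mpr fun f hf => ?_
  ext p
  induction p using raise_induction i generalizing f with
  | not_range p hp =>
    obtain ⟨g, rfl⟩ : ∃ g, mulCoord i g = f := mem_unitaryPart.mp hf 1
    exact mulCoord_of_not_range i g p hp
  | map_raise q ih =>
    rw [← adjoint_mulCoord_apply]
    exact ih _ (adjoint_mem_unitaryPart ((coordBiIsometry F).norm_map i) hf)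

end HardyBidisk

theorem proposition6p3_general {K : Type u} [NormedAddCommGroup K] [InnerProductSpace ℂ K]
    [CompleteSpace K] (W : BiIsometry K) :
    ((∃ (F : Type u) (_ : NormedAddCommGroup F) (_ : InnerProductSpace ℂ F)
        (_ : CompleteSpace F), W.UnitarilyEquivalent (HardyBidisk.coordBiIsometry F)) ↔
      W.IsPure {0} ∧ W.IsPure {1} ∧ W.DoublyCommuting) ∧
    List.TFAE [
      W.DoublyCommuting,
      W.CharFunctionIsConstantIsometry,
      Isometry W.swap.pivotalOperator,
      Isometry W.pivotalOperator] := by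
  refine ⟨⟨?_, fun ⟨h0, h1, h⟩ => ?_⟩, ?_⟩
  · rintro ⟨F, _, _, _, hF⟩
    have isPure (i : Fin 2) : W.IsPure {i} := BiIsometry.isPure_singleton_of_unitaryPart_eq_bot <|
      hF.unitaryPart_eq_bot (HardyBidisk.unitaryPart_coordBiIsometry F i)
    exact ⟨isPure 0, isPure 1, hF.doublyCommuting (HardyBidisk.doublyCommuting_coordBiIsometry F)⟩
  · exact ⟨W.jointWanderingSpace, _, _, inferInstance,
      BiIsometry.unitarilyEquivalent_coordBiIsometry <|
        h.isHilbertSum (h.unitaryPart_eq_bot h0) (h.unitaryPart_eq_bot h1)⟩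
  tfae_have 2 ↔ 1 := BiIsometry.charFunctionIsConstantIsometry_iff
  tfae_have 3 ↔ 1 :=
    BiIsometry.isometry_pivotalOperator_iff.trans BiIsometry.doublyCommuting_swap_iff
  tfae_have 4 ↔ 1 := BiIsometry.isometry_pivotalOperator_iff
  tfae_finish

theorem proposition6p3 {K : Type u} [NormedAddCommGroup K] [InnerProductSpace ℂ K]
    [CompleteSpace K] (W : BiIsometry K) (h0 : W.IsPure {0}) (h1 : W.IsPure {1}) :
    List.TFAE [
      ∃ (F : Type u) (_ : NormedAddCommGroup F) (_ : InnerProductSpace ℂ F)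
        (_ : CompleteSpace F), W.UnitarilyEquivalent (HardyBidisk.coordBiIsometry F),
      W.DoublyCommuting,
      W.CharFunctionIsConstantIsometry,
      Isometry W.swap.pivotalOperator,
      Isometry W.pivotalOperator] := by
  obtain ⟨hmodel, htfae⟩ := proposition6p3_general W
  exact List.tfae_cons_cons.mpr ⟨hmodel.trans (by simp only [h0, h1, true_and]), htfae⟩
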